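/- Let $A\in\mathbb R^{m\times n}$ ($m\ge n$) have rank $p$ and let $B\in\mathbb R^{m\times\ell}$ ($m\ge\ell$) have rank $q\le p$. Let $0<\epsilon<1/3$, $0<\delta<1$, let $\omega=\operatorname{rank}([A\,;B])$ be the rank of the matrix obtained by placing the columns of $B$ next to those of $A$, and let $r\ge 1$ be an integer with $$\frac{243(\omega^2+\omega)}{\epsilon^2\delta}\le r\le m .$$ Let $\Omega=SD\in\mathbb R^{r\times m}$ be the Clarkson–Woodruff sparse embedding: each column of $S\in\mathbb R^{r\times m}$ is one of the $r$ standard basis vectors of $\mathbb R^r$, $D\in\mathbb R^{m\times m}$ is diagonal with diagonal entries in $\{+1,-1\}$, and all columns of $S$ and all diagonal entries of $D$ are chosen independently and uniformly. For nonzero vectors $u,v$ put $\sigma(u,v)=|u^{T}v|/(\|u\|_2\|v\|_2)$. For matrices $F,G$ with the same number of rows and $\operatorname{rank}F\ge\operatorname{rank}G=q$, the canonical correlations $\sigma_1(F,G),\dots,\sigma_q(F,G)$ are defined recursively by $$\sigma_i(F,G)=\max \sigma(Fx,Gy)=:\sigma(Fx_i,Gy_i),$$ the maximum being over all $x,y$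 with $Fx\ne0$, $Fx\perp Fx_1,\dots,Fx_{i-1}$, $Gy\neq 0$, $Gy\perp Gy_1,\dots,Gy_{i-1}$; the vectors $x_i/\|Fx_i\|_2$ and $y_i/\|Gy_i\|_2$ are called canonical weights (they are not unique). The pair $(A,B)$ has canonical correlations $\sigma_1(A,B),\dots,\sigma_q(A,B)$, and with probability at least $1-\delta$ the pair $(\hat A,\hat B)=(\Omega A,\Omega B)$ also has $q$ canonical correlations (in particular $\operatorname{rank}\hat A\ge\operatorname{rank}\hat B=q$) and the following hold simultaneously, for every choice $w_1,\dots,w_q$ and $p_1,\dots,p_q$ of canonical weights of $(\hat A,\hat B)$: (a) for every $1\le i\le q$, $\ |\sigma_i(A,B)-\sigma_i(\hat A,\hat B)|\le \epsilon+2\epsilon^2/9$; (b) for every $1\le c\le q$, $\ \dfrac1{1+\epsilon/3}\le\|Aw_c\|_2^2\le\dfrac1{1-\epsilon/3}$, and for all $i\ne j$, $\ |\langle Aw_i,Aw_j\rangle|\le\dfrac{\epsilon}{3-\epsilon}$; the same holds with $Bp_1,\dots,Bp_q$ in place of $Aw_1,\dots,Aw_q$; (c) for every $1\le i\le q$, $$\frac{\sigma_i(A,B)}{1+\epsilon/3}-\frac{\epsilon/3}{1-\epsilon/9}\le\sigma(Aw_i,Bp_i)\le\frac{\sigma_i(A,B)}{1-\epsilon/3}+\frac{\epsilon/3}{(1-\epsilon/3)^2}.$$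 -/

import Mathlib

namespace SketchedCCA

open MeasureTheory Matrix

/-- The Euclidean norm of a real vector. -/
noncomputable def norm2 {m : ℕ} (u : Fin m → ℝ) : ℝ := ‖WithLp.toLp 2 u‖

/-- The correlation `σ(u, v) = |uᵀ v| / (‖u‖₂ ‖v‖₂)` of two (nonzero) vectors. -/
noncomputable def corr {m : ℕ} (u v : Fin m → ℝ) : ℝ :=
  |u ⬝ᵥ v| / (norm2 u * norm2 v)

/-- The vectors `u` with `A u ≠ 0` and `A u ⟂ A (x j)` for all `j < i`. -/
def admissible {m n q : ℕ} (A : Matrix (Fin m) (Fin n) ℝ) (x : Fin q → Fin n → ℝ)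
    (i : Fin q) : Set (Fin n → ℝ) :=
  {u | A *ᵥ u ≠ 0 ∧ ∀ j : Fin q, j < i → (A *ᵥ u) ⬝ᵥ (A *ᵥ x j) = 0}

/-- `σ` are the canonical correlations of the pair `(A, B)` with `q = rank B ≤ rank A`, and
`x`, `y` are vectors that attain the maxima in their recursive definition: for every `i`,
`σ i = max σ(A u, B v)` over the admissible `u`, `v`, and the maximum is attained
at `(x i, y i)`. The maximizers `x`, `y` are not unique. -/
structure IsCCA {m n l q : ℕ} (A : Matrix (Fin m) (Fin n) ℝ) (B : Matrix (Fin m) (Fin l) ℝ)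
    (σ : Fin q → ℝ) (x : Fin q → Fin n → ℝ) (y : Fin q → Fin l → ℝ) : Prop where
  rank_right : B.rank = q
  rank_left : q ≤ A.rank
  left_mem : ∀ i, x i ∈ admissible A x i
  right_mem : ∀ i, y i ∈ admissible B y i
  attained : ∀ i, σ i = corr (A *ᵥ x i) (B *ᵥ y i)
  maximal : ∀ i, ∀ u ∈ admissible A x i, ∀ v ∈ admissible B y i,
    corr (A *ᵥ u) (B *ᵥ v) ≤ σ i

/-- The canonical weights `x i / ‖A (x i)‖₂` belonging to maximizers `x`. -/
noncomputable def weight {m n q : ℕ} (A : Matrix (Fin m) (Fin n) ℝ) (x : Fin q → Fin n → ℝ)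
    (i : Fin q) : Fin n → ℝ :=
  (norm2 (A *ᵥ x i))⁻¹ • x i

/-- The outcomes of the random choices: for every `j`, the index of the standard basis vector
that is column `j` of `S`, and the sign of the `j`-th diagonal entry of `D`. -/
abbrev Sample (m r : ℕ) : Type := (Fin m → Fin r) × (Fin m → Bool)

/-- All the choices are independent and uniform. -/
noncomputable def sampleLaw (m r : ℕ) : Measure (Sample m r) :=
  (Measure.pi fun _ : Fin m => ProbabilityTheory.uniformOn (Set.univ : Set (Fin r))).prod
    (Measure.pi fun _ : Fin m => ProbabilityTheory.uniformOn (Set.univ : Set Bool))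

/-- The `r × m` matrix whose `j`-th column is the standard basis vector with index `h j`. -/
def selectMatrix {m r : ℕ} (h : Fin m → Fin r) : Matrix (Fin r) (Fin m) ℝ :=
  Matrix.of fun k j => if k = h j then 1 else 0

/-- The diagonal matrix of signs. -/
def signMatrix {m : ℕ} (s : Fin m → Bool) : Matrix (Fin m) (Fin m) ℝ :=
  Matrix.diagonal fun j => if s j then 1 else -1

/-- The sparse embedding `Ω = S D`. -/
def sketch {m r : ℕ} (z : Sample m r) : Matrix (Fin r) (Fin m) ℝ :=
  selectMatrix z.1 * signMatrix z.2

end SketchedCCA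

open SketchedCCA Matrix

namespace SketchedCCA

open MeasureTheory Matrix

/-! The correlation of `A *ᵥ u` and `B *ᵥ v` depends only on these two vectors, so canonical
correlations belong to the pair of column spaces (`isCCA_iff`), and the sketch enters only as a
linear map on their sum. The proof separates a deterministic perturbation argument from one
probabilistic estimate, joined by the notion `IsEmbedding`: inner products on a subspace are
preserved up to relative error `η`, here `η = ε / 15`.

Deterministic part. Canonical vectors are biorthogonal by first-order optimality, and this gives
both halves of a Courant–Fischer principle: `exists_le_inner` bounds correlations from below on the
span of the first canonical vectors, and `inner_le` bounds them from above under orthogonality on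
one side only. A dimension count produces a vector to which both apply, and `le_of_map` compares the
correlations before and after an almost isometric map. Applied to the sketch and to its left
inverse, it gives a two-sided comparison. The bounds on the weights follow since their sketched
images are orthonormal and biorthogonal.

Probabilistic part. The error of a sketched inner product is an off-diagonal quadratic form in
random signs, supported on hash collisions; its mean square is at most `(‖u‖²‖v‖² + ⟨u, v⟩²) / r`.
Summing over pairs from an orthonormal basis of a `w`-dimensional space bounds the expected squared
Frobenius norm of the Gram error by `(w² + w) / r`, and Markov's inequality finishes
(`prob_isEmbedding`). -/

/-- Canonical correlations `σ` of two subspaces `U`, `V`, attained at the vectors `a`, `b`. -/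
structure IsCanonical {E : Type*} [NormedAddCommGroup E] [InnerProductSpace ℝ E] {q : ℕ}
    (U V : Submodule ℝ E) (σ : Fin q → ℝ) (a b : Fin q → E) : Prop where
  left_mem : ∀ i, a i ∈ U
  right_mem : ∀ i, b i ∈ V
  left_ne : ∀ i, a i ≠ 0
  right_ne : ∀ i, b i ≠ 0
  left_orth : ∀ i j, j < i → inner ℝ (a i) (a j) = 0
  right_orth : ∀ i j, j < i → inner ℝ (b i) (b j) = 0
  attained : ∀ i, |inner ℝ (a i) (b i)| = σ i * (‖a i‖ * ‖b i‖)
  maximal : ∀ i, ∀ u ∈ U, (∀ j, j < i → inner ℝ u (a j) = 0) →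
    ∀ v ∈ V, (∀ j, j < i → inner ℝ v (b j) = 0) → |inner ℝ u v| ≤ σ i * (‖u‖ * ‖v‖)

/-! ### Biorthogonality of canonical vectors -/

namespace IsCanonical

variable {E : Type*} [NormedAddCommGroup E] [InnerProductSpace ℝ E] {q : ℕ}
  {U V : Submodule ℝ E} {σ : Fin q → ℝ} {a b : Fin q → E}

theorem symm (h : IsCanonical U V σ a b) : IsCanonical V U σ b a where
  left_mem := h.right_mem
  right_mem := h.left_mem
  left_ne := h.right_ne
  right_ne := h.left_ne
  left_orth := h.right_orth
  right_orth := h.left_orth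
  attained i := by rw [real_inner_comm, h.attained, mul_comm ‖a i‖]
  maximal i u hu hu' v hv hv' := by
    rw [real_inner_comm, mul_comm ‖u‖]; exact h.maximal i v hv hv' u hu hu'

theorem nonneg (h : IsCanonical U V σ a b) (i : Fin q) : 0 ≤ σ i := by
  have h1 : 0 < ‖a i‖ * ‖b i‖ :=
    mul_pos (norm_pos_iff.2 (h.left_ne i)) (norm_pos_iff.2 (h.right_ne i))
  have h2 := abs_nonneg (inner ℝ (a i) (b i))
  rw [h.attained] at h2
  exact nonneg_of_mul_nonneg_left h2 h1

theorem le_one (h : IsCanonical U V σ a b) (i : Fin q) : σ i ≤ 1 := by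
  have h1 : 0 < ‖a i‖ * ‖b i‖ :=
    mul_pos (norm_pos_iff.2 (h.left_ne i)) (norm_pos_iff.2 (h.right_ne i))
  have h2 := abs_real_inner_le_norm (a i) (b i)
  rw [h.attained] at h2
  exact le_of_mul_le_mul_right (by linarith) h1

/-- The later optimal pair is still a competitor at the earlier stage. -/
theorem antitone (h : IsCanonical U V σ a b) {i j : Fin q} (hij : j ≤ i) : σ i ≤ σ j := by
  have h1 : 0 < ‖a i‖ * ‖b i‖ :=
    mul_pos (norm_pos_iff.2 (h.left_ne i)) (norm_pos_iff.2 (h.right_ne i))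
  have h2 := h.maximal j (a i) (h.left_mem i) (fun k hk => h.left_orth i k (hk.trans_le hij))
    (b i) (h.right_mem i) (fun k hk => h.right_orth i k (hk.trans_le hij))
  rw [h.attained] at h2
  exact le_of_mul_le_mul_right h2 h1

theorem left_orth' (h : IsCanonical U V σ a b) {i j : Fin q} (hij : i ≠ j) :
    inner ℝ (a i) (a j) = 0 := by
  rcases lt_or_gt_of_ne hij with h1 | h1
  · rw [real_inner_comm]; exact h.left_orth j i h1
  · exact h.left_orth i j h1

/-- First-order optimality of a maximizing pair. -/
theorem inner_eq_zero (h : IsCanonical U V σ a b) (j : Fin q) {v : E} (hv : v ∈ V)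
    (hv' : ∀ k, k ≤ j → inner ℝ v (b k) = 0) : inner ℝ (a j) v = 0 := by
  set α := inner ℝ (a j) (b j) with hα
  set β := inner ℝ (a j) v with hβ
  have hbv : inner ℝ (b j) v = 0 := by rw [real_inner_comm]; exact hv' j le_rfl
  have hatt : α ^ 2 = (σ j) ^ 2 * (‖a j‖ ^ 2 * ‖b j‖ ^ 2) := by
    rw [← sq_abs, hα, h.attained j]; ring
  -- Compare the pair `(a j, b j)` with `(a j, b j + t • v)`. Attainment cancels the constant term,
  -- so the discriminant of a nonnegative quadratic is `(2αβ)²`, which forces `αβ = 0`.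
  have key : ∀ t : ℝ, 0 ≤ ((σ j) ^ 2 * (‖a j‖ ^ 2 * ‖v‖ ^ 2) - β ^ 2) * (t * t)
      + (-(2 * (α * β))) * t + 0 := by
    intro t
    have h1 := h.maximal j (a j) (h.left_mem j) (fun k hk => h.left_orth j k hk)
      (b j + t • v) (V.add_mem (h.right_mem j) (V.smul_mem t hv)) (fun k hk => by
        rw [inner_add_left, h.right_orth j k hk, inner_smul_left, hv' k hk.le]; simp)
    have h2 := pow_le_pow_left₀ (abs_nonneg _) h1 2
    have h3 : ‖b j + t • v‖ ^ 2 = ‖b j‖ ^ 2 + t ^ 2 * ‖v‖ ^ 2 := by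
      rw [norm_add_sq_real, inner_smul_right, hbv, norm_smul, mul_pow, Real.norm_eq_abs, sq_abs]
      ring
    rw [sq_abs, inner_add_right, inner_smul_right, mul_pow, mul_pow, h3, ← hα, ← hβ] at h2
    nlinarith
  have h4 := discrim_le_zero key
  rw [discrim] at h4
  have h5 : (α * β) ^ 2 = 0 := le_antisymm (by nlinarith) (sq_nonneg _)
  rcases mul_eq_zero.1 (pow_eq_zero_iff (two_ne_zero)|>.1 h5) with h6 | h6
  -- If `α = 0`, the maximum itself is zero, and `v` competes directly with `b j`.
  · have h7 : σ j = 0 := by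
      have h8 := h.attained j
      rw [← hα, h6, abs_zero] at h8
      have h1 : 0 < ‖a j‖ * ‖b j‖ :=
        mul_pos (norm_pos_iff.2 (h.left_ne j)) (norm_pos_iff.2 (h.right_ne j))
      rcases mul_eq_zero.1 h8.symm with h9 | h9
      · exact h9
      · exact absurd h9 h1.ne'
    have h8 := h.maximal j (a j) (h.left_mem j) (fun k hk => h.left_orth j k hk) v hv
      (fun k hk => hv' k hk.le)
    rw [h7, zero_mul] at h8
    exact abs_eq_zero.1 (le_antisymm h8 (abs_nonneg _))
  · exact h6

theorem inner_left_right (h : IsCanonical U V σ a b) {i j : Fin q} (hij : i ≠ j) :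
    inner ℝ (a i) (b j) = 0 := by
  rcases lt_or_gt_of_ne hij with h1 | h1
  · exact h.inner_eq_zero i (h.right_mem j) (fun k hk => h.right_orth j k (hk.trans_lt h1))
  · rw [real_inner_comm]
    exact h.symm.inner_eq_zero j (h.left_mem i) (fun k hk => h.left_orth i k (hk.trans_lt h1))

/-- Rescaling the maximizers. -/
theorem smul (h : IsCanonical U V σ a b) {c d : Fin q → ℝ} (hc : ∀ i, c i ≠ 0)
    (hd : ∀ i, d i ≠ 0) :
    IsCanonical U V σ (fun i => c i • a i) (fun i => d i • b i) where
  left_mem i := U.smul_mem _ (h.left_mem i)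
  right_mem i := V.smul_mem _ (h.right_mem i)
  left_ne i := smul_ne_zero (hc i) (h.left_ne i)
  right_ne i := smul_ne_zero (hd i) (h.right_ne i)
  left_orth i j hij := by simp [inner_smul_left, inner_smul_right, h.left_orth i j hij]
  right_orth i j hij := by simp [inner_smul_left, inner_smul_right, h.right_orth i j hij]
  attained i := by
    rw [inner_smul_left, inner_smul_right, abs_mul, abs_mul, h.attained, norm_smul, norm_smul]
    simp only [Real.norm_eq_abs, conj_trivial]; ring
  maximal i u hu hu' v hv hv' := by
    refine h.maximal i u hu (fun j hj => ?_) v hv (fun j hj => ?_)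
    · have := hu' j hj
      rw [inner_smul_right] at this
      exact (mul_eq_zero.1 this).resolve_left (hc j)
    · have := hv' j hj
      rw [inner_smul_right] at this
      exact (mul_eq_zero.1 this).resolve_left (hd j)

/-- Upper half of Courant–Fischer, with no orthogonality asked of `u`. By first-order optimality `v`
is orthogonal to every earlier `a j`, so subtracting from `u` its projection onto their span leaves
the inner product unchanged and does not increase the norm. -/
theorem inner_le (h : IsCanonical U V σ a b) (i : Fin q) {u v : E} (hu : u ∈ U) (hv : v ∈ V)
    (hv' : ∀ j, j < i → inner ℝ v (b j) = 0) : |inner ℝ u v| ≤ σ i * (‖u‖ * ‖v‖) := by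
  set S : Submodule ℝ E := Submodule.span ℝ (a '' Set.Iio i) with hS
  have : FiniteDimensional ℝ S :=
    FiniteDimensional.span_of_finite ℝ ((Set.toFinite _).image a)
  have hSU : S ≤ U := Submodule.span_le.2 (by rintro _ ⟨j, -, rfl⟩; exact h.left_mem j)
  set u₁ : E := S.starProjection u with hu₁
  have hu₁S : u₁ ∈ S := Submodule.starProjection_apply_mem S u
  have hperp : u - u₁ ∈ Sᗮ := Submodule.sub_starProjection_mem_orthogonal u
  have hSv : ∀ s ∈ S, inner ℝ s v = 0 := by
    intro s hs
    induction hs using Submodule.span_induction with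
    | mem x hx =>
      obtain ⟨j, hj, rfl⟩ := hx
      exact h.inner_eq_zero j hv (fun k hk => hv' k (lt_of_le_of_lt hk hj))
    | zero => simp
    | add x y _ _ hx hy => rw [inner_add_left, hx, hy, add_zero]
    | smul c x _ hx => rw [inner_smul_left, hx, mul_zero]
  have h1 := h.maximal i (u - u₁) (U.sub_mem hu (hSU hu₁S))
    (fun j hj => by
      rw [real_inner_comm]
      exact hperp (a j) (Submodule.subset_span ⟨j, hj, rfl⟩)) v hv hv'
  rw [inner_sub_left, hSv u₁ hu₁S, sub_zero] at h1
  have h2 : ‖u - u₁‖ ≤ ‖u‖ := by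
    have h3 : inner ℝ (u - u₁) u₁ = 0 := by rw [real_inner_comm]; exact hperp u₁ hu₁S
    have h4 : ‖u‖ ^ 2 = ‖u - u₁‖ ^ 2 + ‖u₁‖ ^ 2 := by
      conv_lhs => rw [← sub_add_cancel u u₁]
      rw [norm_add_sq_real, h3]; ring
    exact le_of_sq_le_sq (by nlinarith [sq_nonneg ‖u₁‖]) (norm_nonneg _)
  exact h1.trans (mul_le_mul_of_nonneg_left
    (mul_le_mul_of_nonneg_right h2 (norm_nonneg _)) (h.nonneg i))

end IsCanonical

/-! ### Perturbation of canonical correlations -/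

namespace IsCanonical

variable {E : Type*} [NormedAddCommGroup E] [InnerProductSpace ℝ E] {q : ℕ}
  {U V : Submodule ℝ E} {σ : Fin q → ℝ} {a b : Fin q → E}

theorem normalize (h : IsCanonical U V σ a b) :
    IsCanonical U V σ (fun i => ‖a i‖⁻¹ • a i) (fun i => ‖b i‖⁻¹ • b i) :=
  h.smul (fun i => inv_ne_zero (norm_ne_zero_iff.2 (h.left_ne i)))
    (fun i => inv_ne_zero (norm_ne_zero_iff.2 (h.right_ne i)))

theorem orthonormal_left (h : IsCanonical U V σ a b) (ha : ∀ i, ‖a i‖ = 1) : Orthonormal ℝ a :=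
  ⟨ha, fun _ _ hij => h.left_orth' hij⟩

/-- Lower half of Courant–Fischer. Transfer the coefficients of `v` to the `a j`, correcting signs
so that each `⟨a j, b j⟩` contributes `σ j`. Biorthogonality leaves `∑ σ j * c j ^ 2`, where only
the `σ j ≥ σ i` occur. -/
theorem exists_le_inner (h : IsCanonical U V σ a b) (ha : ∀ i, ‖a i‖ = 1) (hb : ∀ i, ‖b i‖ = 1)
    (i : Fin q) (c : Fin q → ℝ) (hc : ∀ j, i < j → c j = 0) :
    ∃ u ∈ U, ‖u‖ = ‖∑ j, c j • b j‖ ∧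
      σ i * (‖u‖ * ‖∑ j, c j • b j‖) ≤ inner ℝ u (∑ j, c j • b j) := by
  have hoa := h.orthonormal_left ha
  have hob := h.symm.orthonormal_left hb
  set s : Fin q → ℝ := fun j => if 0 ≤ inner ℝ (a j) (b j) then 1 else -1 with hs
  have hs2 : ∀ j, s j * s j = 1 := by intro j; simp only [hs]; split_ifs <;> norm_num
  have hsσ : ∀ j, s j * inner ℝ (a j) (b j) = σ j := by
    intro j
    have := h.attained j
    rw [ha, hb] at this
    simp only [hs]; split_ifs with h0
    · rw [abs_of_nonneg h0] at this; linarith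
    · rw [abs_of_neg (not_le.1 h0)] at this; linarith
  have hv : ‖∑ j, c j • b j‖ ^ 2 = ∑ j, c j ^ 2 := by
    rw [← real_inner_self_eq_norm_sq, hob.inner_sum]
    simp [sq]
  have hu : ‖∑ j, (c j * s j) • a j‖ ^ 2 = ∑ j, c j ^ 2 := by
    rw [← real_inner_self_eq_norm_sq, hoa.inner_sum]
    refine Finset.sum_congr rfl fun j _ => ?_
    simp only [conj_trivial]
    linear_combination c j ^ 2 * hs2 j
  have huv : ‖∑ j, (c j * s j) • a j‖ = ‖∑ j, c j • b j‖ := by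
    rw [← sq_eq_sq₀ (norm_nonneg _) (norm_nonneg _), hu, hv]
  refine ⟨∑ j, (c j * s j) • a j, U.sum_mem fun j _ => U.smul_mem _ (h.left_mem j), huv, ?_⟩
  have hin : inner ℝ (∑ j, (c j * s j) • a j) (∑ j, c j • b j) = ∑ j, σ j * c j ^ 2 := by
    rw [sum_inner]
    refine Finset.sum_congr rfl fun j _ => ?_
    rw [inner_sum, Finset.sum_eq_single j]
    · rw [inner_smul_left, inner_smul_right]
      simp only [conj_trivial]
      linear_combination c j ^ 2 * hsσ j
    · intro k _ hk
      rw [inner_smul_left, inner_smul_right, h.inner_left_right (Ne.symm hk)]; simp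
    · simp
  rw [hin, huv, ← sq, hv, Finset.mul_sum]
  refine Finset.sum_le_sum fun j _ => ?_
  rcases le_or_gt j i with hj | hj
  · exact mul_le_mul_of_nonneg_right (h.antitone hj) (sq_nonneg _)
  · simp [hc j hj]

/-- There is a nonzero vector supported on the first `i + 1` coordinates
that satisfies `i` linear equations. -/
theorem exists_kernel_vector (M : Fin q → Fin q → ℝ) (i : Fin q) :
    ∃ c : Fin q → ℝ, c ≠ 0 ∧ (∀ j, i < j → c j = 0) ∧ ∀ k, k < i → ∑ j, c j * M j k = 0 := by
  -- The equations fill coordinates below `i`, the support conditions those above. Coordinate `i` of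
  -- the output is always zero, so this endomorphism is not surjective, hence not injective.
  let f : (Fin q → ℝ) →ₗ[ℝ] (Fin q → ℝ) :=
    { toFun := fun c k => if k < i then ∑ j, c j * M j k else if i < k then c k else 0
      map_add' := by
        intro x y; ext k
        simp only [Pi.add_apply, add_mul, Finset.sum_add_distrib]
        split_ifs <;> simp
      map_smul' := by
        intro t x; ext k
        simp only [Pi.smul_apply, smul_eq_mul, mul_assoc, ← Finset.mul_sum, RingHom.id_apply]
        split_ifs <;> simp }
  have hf : ¬ Function.Injective f := by
    rw [LinearMap.injective_iff_surjective]
    intro hs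
    obtain ⟨c, hc⟩ := hs (fun _ => 1)
    have := congrFun hc i
    simp [f] at this
  rw [injective_iff_map_eq_zero] at hf
  push Not at hf
  obtain ⟨c, hc, hc0⟩ := hf
  refine ⟨c, hc0, fun j hj => ?_, fun k hk => ?_⟩
  · simpa [f, hj, not_lt.2 hj.le] using congrFun hc j
  · simpa [f, hk] using congrFun hc k

/-- Perturbation bound for canonical correlations under an almost isometric linear map. -/
theorem le_of_map {E' : Type*} [NormedAddCommGroup E'] [InnerProductSpace ℝ E']
    {U' V' : Submodule ℝ E'} {σ' : Fin q → ℝ} {a' b' : Fin q → E'}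
    (h : IsCanonical U V σ a b) (h' : IsCanonical U' V' σ' a' b') (T : E →ₗ[ℝ] E')
    (hU : ∀ u ∈ U, T u ∈ U') (hV : ∀ v ∈ V, T v ∈ V') {κ : ℝ}
    (hT : ∀ x ∈ U ⊔ V, ∀ y ∈ U ⊔ V,
      |inner ℝ (T x) (T y) - inner ℝ x y| ≤ κ * (‖x‖ * ‖y‖)) (i : Fin q) :
    σ i ≤ σ' i * (1 + κ) + κ := by
  wlog hn : (∀ i, ‖a i‖ = 1) ∧ (∀ i, ‖b i‖ = 1) generalizing a b
  · refine this h.normalize ⟨fun i => ?_, fun i => ?_⟩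
    · exact norm_smul_inv_norm (𝕜 := ℝ) (h.left_ne i)
    · exact norm_smul_inv_norm (𝕜 := ℝ) (h.right_ne i)
  -- Choose `v` in the span of the `b j` with `j ≤ i` so that `T v` is orthogonal to the earlier `b'
  -- k`; both halves of Courant–Fischer then apply to it.
  obtain ⟨c, hc0, hci, hck⟩ := exists_kernel_vector (fun j k => inner ℝ (T (b j)) (b' k)) i
  obtain ⟨u, hu, huv, hle⟩ := h.exists_le_inner hn.1 hn.2 i c hci
  set v := ∑ j, c j • b j with hv
  have hvV : v ∈ V := V.sum_mem fun j _ => V.smul_mem _ (h.right_mem j)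
  have hv0 : v ≠ 0 := by
    intro h0
    exact hc0 (funext (Fintype.linearIndependent_iff.1
      (h.symm.orthonormal_left hn.2).linearIndependent c h0))
  have hvn : 0 < ‖v‖ := norm_pos_iff.2 hv0
  have hup := h'.inner_le i (hU u hu) (hV v hvV) (fun k hk => by
    rw [hv, map_sum, sum_inner, ← hck k hk]
    refine Finset.sum_congr rfl fun j _ => ?_
    rw [map_smul, inner_smul_left]; simp)
  have hu' : u ∈ U ⊔ V := Submodule.mem_sup_left hu
  have hv' : v ∈ U ⊔ V := Submodule.mem_sup_right hvV
  have e1 := (abs_le.1 (hT u hu' v hv')).1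
  have e2 := (abs_le.1 (hT u hu' u hu')).2
  have e3 := (abs_le.1 (hT v hv' v hv')).2
  rw [real_inner_self_eq_norm_sq, real_inner_self_eq_norm_sq] at e2 e3
  rw [huv] at e1 e2 hle
  -- AM-GM, using `‖u‖ = ‖v‖`.
  have e4 : ‖T u‖ * ‖T v‖ ≤ (1 + κ) * (‖v‖ * ‖v‖) := by
    nlinarith [sq_nonneg (‖T u‖ - ‖T v‖)]
  have e5 := (le_abs_self _).trans
    (hup.trans (mul_le_mul_of_nonneg_left e4 (h'.nonneg i)))
  exact le_of_mul_le_mul_right (by nlinarith) (mul_pos hvn hvn)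

end IsCanonical

/-! ### Existence of canonical correlations -/

theorem exists_isMax_inner {E : Type*} [NormedAddCommGroup E] [InnerProductSpace ℝ E]
    [FiniteDimensional ℝ E] {U V : Submodule ℝ E} (hU : U ≠ ⊥) (hV : V ≠ ⊥) :
    ∃ u ∈ U, ∃ v ∈ V, ‖u‖ = 1 ∧ ‖v‖ = 1 ∧
      ∀ x ∈ U, ∀ y ∈ V, |inner ℝ x y| ≤ |inner ℝ u v| * (‖x‖ * ‖y‖) := by
  have hsphere : ∀ W : Submodule ℝ E, IsCompact (Metric.sphere (0 : E) 1 ∩ W) := fun W =>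
    (isCompact_sphere 0 1).inter_right W.closed_of_finiteDimensional
  have hne : ∀ W : Submodule ℝ E, W ≠ ⊥ → (Metric.sphere (0 : E) 1 ∩ W).Nonempty := by
    intro W hW
    obtain ⟨x, hx, hx0⟩ := Submodule.exists_mem_ne_zero_of_ne_bot hW
    exact ⟨‖x‖⁻¹ • x, by simpa using norm_smul_inv_norm (𝕜 := ℝ) hx0, W.smul_mem _ hx⟩
  obtain ⟨⟨u, v⟩, ⟨⟨hu1, hu⟩, ⟨hv1, hv⟩⟩, hmax⟩ :=
    ((hsphere U).prod (hsphere V)).exists_isMaxOn ((hne U hU).prod (hne V hV))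
      (f := fun z : E × E => |inner ℝ z.1 z.2|) (by fun_prop)
  refine ⟨u, hu, v, hv, by simpa using hu1, by simpa using hv1, fun x hx y hy => ?_⟩
  by_cases hx0 : x = 0
  · simp [hx0]
  by_cases hy0 : y = 0
  · simp [hy0]
  have h1 := hmax (a := (‖x‖⁻¹ • x, ‖y‖⁻¹ • y))
    ⟨⟨by simpa using norm_smul_inv_norm (𝕜 := ℝ) hx0, U.smul_mem _ hx⟩,
      ⟨by simpa using norm_smul_inv_norm (𝕜 := ℝ) hy0, V.smul_mem _ hy⟩⟩
  simp only [inner_smul_left, inner_smul_right, abs_mul, Set.mem_ofPred_eq, conj_trivial,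
    abs_inv, abs_norm] at h1
  have hxn := norm_pos_iff.2 hx0
  have hyn := norm_pos_iff.2 hy0
  have h2 : |inner ℝ x y| = (‖x‖⁻¹ * (‖y‖⁻¹ * |inner ℝ x y|)) * (‖x‖ * ‖y‖) := by
    field_simp
  rw [h2]
  refine mul_le_mul_of_nonneg_right ?_ (by positivity)
  linarith

theorem finrank_inf_orthogonal_singleton {E : Type*} [NormedAddCommGroup E]
    [InnerProductSpace ℝ E] [FiniteDimensional ℝ E] {U : Submodule ℝ E} {u : E} (hu : u ∈ U)
    (hu0 : u ≠ 0) :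
    Module.finrank ℝ (U ⊓ (Submodule.span ℝ {u})ᗮ : Submodule ℝ E) + 1
      = Module.finrank ℝ U := by
  have h1 : Submodule.span ℝ {u} ≤ U := (Submodule.span_singleton_le_iff_mem u U).2 hu
  have h2 := Submodule.finrank_add_inf_finrank_orthogonal h1
  rw [finrank_span_singleton hu0] at h2
  rw [inf_comm, add_comm]; exact h2

/-- Split off one maximizing pair of unit vectors, then recurse in the orthogonal complements, whose
dimensions drop by exactly one. -/
theorem exists_isCanonical {E : Type*} [NormedAddCommGroup E] [InnerProductSpace ℝ E]
    [FiniteDimensional ℝ E] (q : ℕ) (U V : Submodule ℝ E) (hU : q ≤ Module.finrank ℝ U)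
    (hV : q ≤ Module.finrank ℝ V) :
    ∃ (σ : Fin q → ℝ) (a b : Fin q → E), IsCanonical U V σ a b := by
  induction q generalizing U V with
  | zero =>
    exact ⟨0, 0, 0, ⟨fun i => i.elim0, fun i => i.elim0, fun i => i.elim0, fun i => i.elim0,
      fun i => i.elim0, fun i => i.elim0, fun i => i.elim0, fun i => i.elim0⟩⟩
  | succ q ih =>
    have hne : ∀ W : Submodule ℝ E, q + 1 ≤ Module.finrank ℝ W → W ≠ ⊥ := by
      rintro W hW rfl
      simp at hW
    obtain ⟨u, hu, v, hv, hu1, hv1, hmax⟩ := exists_isMax_inner (hne U hU) (hne V hV)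
    have hu0 : u ≠ 0 := by rintro rfl; simp at hu1
    have hv0 : v ≠ 0 := by rintro rfl; simp at hv1
    have hUd := finrank_inf_orthogonal_singleton hu hu0
    have hVd := finrank_inf_orthogonal_singleton hv hv0
    obtain ⟨σ, a, b, h⟩ := ih (U ⊓ (Submodule.span ℝ {u})ᗮ) (V ⊓ (Submodule.span ℝ {v})ᗮ)
      (by omega) (by omega)
    have mem : ∀ (W : Submodule ℝ E) (x y : E),
        x ∈ W ⊓ (Submodule.span ℝ {y})ᗮ ↔ x ∈ W ∧ inner ℝ x y = 0 := by
      intro W x y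
      rw [Submodule.mem_inf, Submodule.mem_orthogonal_singleton_iff_inner_left]
    refine ⟨Fin.cons |inner ℝ u v| σ, Fin.cons u a, Fin.cons v b, ?_⟩
    constructor
    · exact Fin.cases hu fun i => ((mem _ _ _).1 (h.left_mem i)).1
    · exact Fin.cases hv fun i => ((mem _ _ _).1 (h.right_mem i)).1
    · exact Fin.cases hu0 h.left_ne
    · exact Fin.cases hv0 h.right_ne
    · intro i j hij
      induction i using Fin.cases with
      | zero => exact absurd hij (Fin.not_lt_zero _)
      | succ i =>
        induction j using Fin.cases with
        | zero => exact ((mem _ _ _).1 (h.left_mem i)).2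
        | succ j => exact h.left_orth i j (Fin.succ_lt_succ_iff.1 hij)
    · intro i j hij
      induction i using Fin.cases with
      | zero => exact absurd hij (Fin.not_lt_zero _)
      | succ i =>
        induction j using Fin.cases with
        | zero => exact ((mem _ _ _).1 (h.right_mem i)).2
        | succ j => exact h.right_orth i j (Fin.succ_lt_succ_iff.1 hij)
    · refine Fin.cases ?_ h.attained
      simp [hu1, hv1]
    · intro i
      induction i using Fin.cases with
      | zero => intro x hx _ y hy _; exact hmax x hx y hy
      | succ i =>
        intro x hx hx' y hy hy'
        refine h.maximal i x ((mem _ _ _).2 ⟨hx, hx' 0 (Fin.succ_pos i)⟩)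
          (fun j hj => hx' j.succ (Fin.succ_lt_succ_iff.2 hj)) y
          ((mem _ _ _).2 ⟨hy, hy' 0 (Fin.succ_pos i)⟩)
          (fun j hj => hy' j.succ (Fin.succ_lt_succ_iff.2 hj))

/-! ### Second moment of the sketched inner product -/

/-- The sign `±1` encoded by a Boolean. -/
def sgn (b : Bool) : ℝ := if b then 1 else -1

theorem sgn_mul_self (b : Bool) : sgn b * sgn b = 1 := by cases b <;> simp [sgn]

theorem sgn_not (b : Bool) : sgn (!b) = -sgn b := by cases b <;> simp [sgn]

theorem sum_eq_zero_of_flip {m : ℕ} (i : Fin m) (F : (Fin m → Bool) → ℝ)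
    (hF : ∀ s, F (Function.update s i (!(s i))) = -F s) : ∑ s, F s = 0 := by
  have hinv : Function.Involutive (fun s : Fin m → Bool => Function.update s i (!(s i))) := by
    intro s; simp
  have h1 : ∑ s, F s = ∑ s, F (Function.update s i (!(s i))) :=
    (Equiv.sum_comp hinv.toPerm F).symm
  simp only [hF, Finset.sum_neg_distrib] at h1
  linarith

theorem sum_sgn_four_eq_zero {m : ℕ} {i j k l : Fin m} (hj : j ≠ i) (hk : k ≠ i) (hl : l ≠ i) :
    ∑ s : Fin m → Bool, sgn (s i) * sgn (s j) * (sgn (s k) * sgn (s l)) = 0 := by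
  refine sum_eq_zero_of_flip i _ fun s => ?_
  simp only [Function.update_self, Function.update_of_ne hj, Function.update_of_ne hk,
    Function.update_of_ne hl, sgn_not]
  ring

/-- Unless `{k, l} = {i, j}`, one of `i` and `j` is absent from `k, l`; flipping its sign makes the
sum cancel. -/
theorem sum_sgn_four {m : ℕ} {i j k l : Fin m} (hij : i ≠ j) :
    ∑ s : Fin m → Bool, sgn (s i) * sgn (s j) * (sgn (s k) * sgn (s l)) =
      2 ^ m * ((if k = i ∧ l = j then 1 else 0) + (if k = j ∧ l = i then 1 else 0)) := by
  have hone : ∀ s : Fin m → Bool, sgn (s i) * sgn (s j) * (sgn (s i) * sgn (s j)) = 1 := by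
    intro s
    linear_combination sgn (s j) * sgn (s j) * sgn_mul_self (s i) + sgn_mul_self (s j)
  have hcard : ∑ s : Fin m → Bool, (1 : ℝ) = 2 ^ m := by simp
  by_cases h1 : k = i ∧ l = j
  · obtain ⟨rfl, rfl⟩ := h1
    simp [hone, hij]
  by_cases h2 : k = j ∧ l = i
  · obtain ⟨rfl, rfl⟩ := h2
    have : ∀ s : Fin m → Bool, sgn (s l) * sgn (s k) * (sgn (s k) * sgn (s l)) = 1 := by
      intro s; rw [← hone s]; ring
    simp [this, hij]
  simp only [h1, h2, if_false, add_zero, mul_zero]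
  by_cases hi : k = i ∨ l = i
  · have hk : k ≠ j := by rintro rfl; rcases hi with hi | hi <;> simp_all
    have hl : l ≠ j := by rintro rfl; rcases hi with hi | hi <;> simp_all
    rw [← sum_sgn_four_eq_zero (i := j) (j := i) (k := k) (l := l) hij hk hl]
    exact Finset.sum_congr rfl fun s _ => by ring
  · push Not at hi
    exact sum_sgn_four_eq_zero hij.symm hi.1 hi.2

/-- Expanding the square, only index pairs matching `(i, j)` or `(j, i)` survive; the zero diagonal
ensures `i ≠ j`. -/
theorem sum_sq_chaos {m : ℕ} (c : Fin m → Fin m → ℝ) (hc : ∀ i, c i i = 0) :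
    ∑ s : Fin m → Bool, (∑ i, ∑ j, c i j * (sgn (s i) * sgn (s j))) ^ 2 =
      2 ^ m * ∑ i, ∑ j, c i j * (c i j + c j i) := by
  have h1 : ∀ s : Fin m → Bool, (∑ i, ∑ j, c i j * (sgn (s i) * sgn (s j))) ^ 2 =
      ∑ i, ∑ j, ∑ k, ∑ l, c i j * c k l * (sgn (s i) * sgn (s j) * (sgn (s k) * sgn (s l))) := by
    intro s
    rw [sq, Finset.sum_mul]
    refine Finset.sum_congr rfl fun i _ => ?_
    rw [Finset.sum_mul]
    refine Finset.sum_congr rfl fun j _ => ?_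
    rw [Finset.mul_sum]
    refine Finset.sum_congr rfl fun k _ => ?_
    rw [Finset.mul_sum]
    exact Finset.sum_congr rfl fun l _ => by ring
  simp only [h1]
  rw [Finset.sum_comm, Finset.mul_sum]
  refine Finset.sum_congr rfl fun i _ => ?_
  rw [Finset.sum_comm, Finset.mul_sum]
  refine Finset.sum_congr rfl fun j _ => ?_
  rw [Finset.sum_comm]
  have h2 : ∀ k, ∑ s : Fin m → Bool, ∑ l,
      c i j * c k l * (sgn (s i) * sgn (s j) * (sgn (s k) * sgn (s l))) =
      ∑ l, c i j * c k l * (2 ^ m *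
        ((if k = i ∧ l = j then 1 else 0) + (if k = j ∧ l = i then 1 else 0))) := by
    intro k
    rw [Finset.sum_comm]
    refine Finset.sum_congr rfl fun l _ => ?_
    rw [← Finset.mul_sum]
    by_cases hij : i = j
    · simp [hij, hc]
    rw [sum_sgn_four hij]
  simp only [h2]
  simp only [mul_add, Finset.sum_add_distrib, ite_and, mul_ite, mul_one, mul_zero,
    Finset.sum_ite_irrel, Finset.sum_ite_eq', Finset.mem_univ, if_true,
    Finset.sum_const_zero]
  ring

/-- Collision probability `1 / r`. Exchanging `h i` with an independent index `k` turns `h i = h j`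
into `k = h j`, which has one solution `k` for each `h`. -/
theorem sum_collision {m r : ℕ} {i j : Fin m} (hij : i ≠ j) :
    (r : ℝ) * ∑ h : Fin m → Fin r, (if h i = h j then (1 : ℝ) else 0) = (r : ℝ) ^ m := by
  let φ : (Fin m → Fin r) × Fin r → (Fin m → Fin r) × Fin r :=
    fun z => (Function.update z.1 i z.2, z.1 i)
  have hinv : Function.Involutive φ := by
    rintro ⟨h, k⟩; simp [φ]
  have h1 := Equiv.sum_comp hinv.toPerm
    (fun z : (Fin m → Fin r) × Fin r => if z.1 i = z.1 j then (1 : ℝ) else 0)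
  simp only [Function.Involutive.coe_toPerm, φ, Function.update_self,
    Function.update_of_ne hij.symm, Fintype.sum_prod_type] at h1
  simp only [Finset.sum_ite_eq', Finset.mem_univ, if_true, Finset.sum_const, Finset.card_univ,
    Fintype.card_pi, Fintype.card_fin, Finset.prod_const, nsmul_eq_mul] at h1
  have h2 : ∀ h : Fin m → Fin r, ∑ _k : Fin r, (if h i = h j then (1 : ℝ) else 0) =
      r * (if h i = h j then 1 else 0) := by
    intro h
    rw [Finset.sum_const, Finset.card_univ, Fintype.card_fin, nsmul_eq_mul]
  rw [Finset.mul_sum, ← Finset.sum_congr rfl fun h _ => h2 h]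
  exact h1.symm.trans (by simp)

theorem sketch_mulVec {m r : ℕ} (z : Sample m r) (u : Fin m → ℝ) (k : Fin r) :
    (sketch z *ᵥ u) k = ∑ j, (if k = z.1 j then 1 else 0) * (sgn (z.2 j) * u j) := by
  rw [sketch, ← Matrix.mulVec_mulVec]
  simp [Matrix.mulVec, dotProduct, selectMatrix, signMatrix, sgn, Matrix.diagonal_apply]

/-- The Gram matrix of the sketch has unit diagonal, so only collisions of distinct columns
contribute to the error. -/
theorem sketch_dotProduct {m r : ℕ} (z : Sample m r) (u v : Fin m → ℝ) :
    (sketch z *ᵥ u) ⬝ᵥ (sketch z *ᵥ v) - u ⬝ᵥ v =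
      ∑ i, ∑ j, (if i ≠ j then (if z.1 i = z.1 j then 1 else 0) * (u i * v j) else 0)
        * (sgn (z.2 i) * sgn (z.2 j)) := by
  have h1 : (sketch z *ᵥ u) ⬝ᵥ (sketch z *ᵥ v) = ∑ i, ∑ j,
      (if z.1 i = z.1 j then 1 else 0) * (u i * v j) * (sgn (z.2 i) * sgn (z.2 j)) := by
    simp only [dotProduct, sketch_mulVec, Finset.sum_mul_sum]
    rw [Finset.sum_comm]
    refine Finset.sum_congr rfl fun i _ => ?_
    rw [Finset.sum_comm]
    refine Finset.sum_congr rfl fun j _ => ?_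
    rw [Finset.sum_eq_single (z.1 i)]
    · simp; split_ifs <;> ring
    · intro k _ hk; simp [hk]
    · simp
  rw [h1, dotProduct, ← Finset.sum_sub_distrib]
  refine Finset.sum_congr rfl fun i _ => ?_
  have h2 : u i * v i = ∑ j, if i = j then u i * v j else 0 := by simp
  rw [h2, ← Finset.sum_sub_distrib]
  refine Finset.sum_congr rfl fun j _ => ?_
  by_cases hij : i = j
  · subst hij; simp [sgn_mul_self]
  · simp [hij]

/-- Second moment of the error of a sketched inner product. -/
theorem sum_sq_sketch_error {m r : ℕ} (u v : Fin m → ℝ) :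
    (r : ℝ) * ∑ z : Sample m r, ((sketch z *ᵥ u) ⬝ᵥ (sketch z *ᵥ v) - u ⬝ᵥ v) ^ 2 ≤
      (r : ℝ) ^ m * 2 ^ m * ((u ⬝ᵥ u) * (v ⬝ᵥ v) + (u ⬝ᵥ v) ^ 2) := by
  have h1 : ∀ h : Fin m → Fin r, ∑ s : Fin m → Bool,
      ((sketch (h, s) *ᵥ u) ⬝ᵥ (sketch (h, s) *ᵥ v) - u ⬝ᵥ v) ^ 2 =
      2 ^ m * ∑ i, ∑ j, (if i ≠ j then (if h i = h j then 1 else 0) *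
        (u i * v j * (u i * v j + u j * v i)) else 0) := by
    intro h
    simp only [sketch_dotProduct]
    refine (sum_sq_chaos (fun i j => if i ≠ j then (if h i = h j then 1 else 0) * (u i * v j)
      else 0) (by simp)).trans ?_
    congr 1
    refine Finset.sum_congr rfl fun i _ => Finset.sum_congr rfl fun j _ => ?_
    by_cases hij : i = j
    · simp [hij]
    · simp only [eq_comm (a := h j)]
      split_ifs <;> simp_all
  rw [Fintype.sum_prod_type]
  simp only [h1]
  rw [← Finset.mul_sum, Finset.sum_comm]
  have h2 : (r : ℝ) * (2 ^ m * ∑ i, ∑ h : Fin m → Fin r, ∑ j,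
      (if i ≠ j then (if h i = h j then 1 else 0) *
        (u i * v j * (u i * v j + u j * v i)) else 0)) =
      (r : ℝ) ^ m * 2 ^ m * ∑ i, ∑ j, (if i ≠ j then
        (u i * v j * (u i * v j + u j * v i)) else 0) := by
    simp only [Finset.mul_sum]
    refine Finset.sum_congr rfl fun i _ => ?_
    rw [Finset.sum_comm]
    refine Finset.sum_congr rfl fun j _ => ?_
    by_cases hij : i = j
    · simp [hij]
    · simp only [ne_eq, hij, not_false_eq_true, if_true]
      rw [← sum_collision (r := r) hij]
      simp only [Finset.mul_sum, Finset.sum_mul]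
      exact Finset.sum_congr rfl fun h _ => by ring
  rw [h2]
  refine mul_le_mul_of_nonneg_left ?_ (by positivity)
  have h3 : (u ⬝ᵥ u) * (v ⬝ᵥ v) + (u ⬝ᵥ v) ^ 2 =
      ∑ i, ∑ j, u i * v j * (u i * v j + u j * v i) := by
    simp only [dotProduct, sq, Finset.sum_mul_sum, ← Finset.sum_add_distrib]
    exact Finset.sum_congr rfl fun i _ => Finset.sum_congr rfl fun j _ => by ring
  rw [h3]
  -- The diagonal terms missing on the left are `2 * (u i * v i) ^ 2 ≥ 0`.
  refine Finset.sum_le_sum fun i _ => Finset.sum_le_sum fun j _ => ?_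
  split_ifs with hij
  · rfl
  · push Not at hij
    subst hij
    nlinarith [sq_nonneg (u i * v i)]

theorem sampleLaw_real {m r : ℕ} (hr : 0 < r) (S : Set (Sample m r)) [DecidablePred (· ∈ S)] :
    (sampleLaw m r).real S =
      (Finset.univ.filter (· ∈ S)).card / ((r : ℝ) ^ m * 2 ^ m) := by
  have : NeZero r := ⟨hr.ne'⟩
  have h0 : ∀ (α : Type) [Fintype α] [Nonempty α] [MeasurableSpace α]
      [MeasurableSingletonClass α] (x : α),
      ProbabilityTheory.uniformOn (Set.univ : Set α) {x} = (Fintype.card α : ENNReal)⁻¹ := by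
    intro α _ _ _ _ x
    rw [ProbabilityTheory.uniformOn_univ, Measure.count_singleton, one_div]
  have hfin : IsProbabilityMeasure (sampleLaw m r) := by
    unfold sampleLaw; infer_instance
  have h1 : ∀ z : Sample m r, (sampleLaw m r).real {z} = ((r : ℝ) ^ m * 2 ^ m)⁻¹ := by
    rintro ⟨h, s⟩
    rw [sampleLaw, ← Set.singleton_prod_singleton, measureReal_prod_prod, ← Set.univ_pi_singleton,
      ← Set.univ_pi_singleton]
    simp only [measureReal_def, Measure.pi_pi, h0]
    simp [mul_comm]
  have h2 : S = (Finset.univ.filter (· ∈ S) : Finset (Sample m r)) := by ext; simp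
  conv_lhs => rw [h2]
  rw [← sum_measureReal_singleton]
  simp [h1, div_eq_mul_inv]

/-! ### Consequences of an almost isometric embedding -/

section Embedding

variable {E F : Type*} [NormedAddCommGroup E] [InnerProductSpace ℝ E]
  [NormedAddCommGroup F] [InnerProductSpace ℝ F]

/-- `T` preserves inner products of vectors of `W` up to the relative error `η`. -/
def IsEmbedding (T : E →ₗ[ℝ] F) (W : Submodule ℝ E) (η : ℝ) : Prop :=
  ∀ x ∈ W, ∀ y ∈ W, |inner ℝ (T x) (T y) - inner ℝ x y| ≤ η * (‖x‖ * ‖y‖)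

namespace IsEmbedding

variable {T : E →ₗ[ℝ] F} {W : Submodule ℝ E} {η : ℝ}

theorem mono (h : IsEmbedding T W η) {W' : Submodule ℝ E} (hW : W' ≤ W) : IsEmbedding T W' η :=
  fun x hx y hy => h x (hW hx) y (hW hy)

theorem norm_sq_le (h : IsEmbedding T W η) {x : E} (hx : x ∈ W) :
    ‖T x‖ ^ 2 ≤ (1 + η) * ‖x‖ ^ 2 := by
  have h1 := (abs_le.1 (h x hx x hx)).2
  rw [real_inner_self_eq_norm_sq, real_inner_self_eq_norm_sq] at h1
  linarith

theorem le_norm_sq (h : IsEmbedding T W η) {x : E} (hx : x ∈ W) :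
    (1 - η) * ‖x‖ ^ 2 ≤ ‖T x‖ ^ 2 := by
  have h1 := (abs_le.1 (h x hx x hx)).1
  rw [real_inner_self_eq_norm_sq, real_inner_self_eq_norm_sq] at h1
  linarith

theorem le_norm_mul (h : IsEmbedding T W η) (hη : η < 1) {x y : E} (hx : x ∈ W) (hy : y ∈ W) :
    (1 - η) * (‖x‖ * ‖y‖) ≤ ‖T x‖ * ‖T y‖ := by
  refine le_of_sq_le_sq ?_ (by positivity)
  have h1 := mul_le_mul (h.le_norm_sq hx) (h.le_norm_sq hy)
    (mul_nonneg (by linarith) (sq_nonneg _)) (sq_nonneg _)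
  nlinarith

theorem norm_mul_le (h : IsEmbedding T W η) (hη : 0 ≤ η) {x y : E} (hx : x ∈ W) (hy : y ∈ W) :
    ‖T x‖ * ‖T y‖ ≤ (1 + η) * (‖x‖ * ‖y‖) := by
  refine le_of_sq_le_sq ?_ (by positivity)
  have h1 := mul_le_mul (h.norm_sq_le hx) (h.norm_sq_le hy) (sq_nonneg _)
    (mul_nonneg (by linarith) (sq_nonneg _))
  nlinarith

theorem exists_left_inverse (h : IsEmbedding T W η) (hη : η < 1) :
    ∃ S : F →ₗ[ℝ] E, ∀ x ∈ W, S (T x) = x := by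
  have hker : LinearMap.ker (T ∘ₗ W.subtype) = ⊥ := by
    rw [LinearMap.ker_eq_bot']
    rintro ⟨x, hx⟩ hx0
    have h1 := h.le_norm_sq hx
    have h2 : T x = 0 := hx0
    rw [h2, norm_zero] at h1
    have h3 : ‖x‖ ^ 2 ≤ 0 := by nlinarith [sq_nonneg ‖x‖]
    exact Subtype.ext (by simpa using le_antisymm h3 (sq_nonneg _))
  obtain ⟨S, hS⟩ := LinearMap.exists_leftInverse_of_injective _ hker
  exact ⟨W.subtype ∘ₗ S, fun x hx => congrArg Subtype.val (LinearMap.congr_fun hS ⟨x, hx⟩)⟩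

theorem finrank_map [FiniteDimensional ℝ E] [FiniteDimensional ℝ F] (h : IsEmbedding T W η)
    (hη : η < 1) {U : Submodule ℝ E} (hU : U ≤ W) :
    Module.finrank ℝ (U.map T) = Module.finrank ℝ U := by
  obtain ⟨S, hS⟩ := h.exists_left_inverse hη
  refine le_antisymm (Submodule.finrank_map_le T U) ?_
  have h1 : (U.map T).map S = U := by
    ext x
    constructor
    · rintro ⟨_, ⟨y, hy, rfl⟩, rfl⟩
      rw [hS y (hU hy)]; exact hy
    · intro hx
      exact ⟨T x, ⟨x, hx, rfl⟩, hS x (hU hx)⟩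
  conv_lhs => rw [← h1]
  exact Submodule.finrank_map_le S _

/-- A left inverse of an embedding is an embedding of the image. -/
theorem left_inverse (h : IsEmbedding T W η) (hη0 : 0 ≤ η) (hη : η < 1) {S : F →ₗ[ℝ] E}
    (hS : ∀ x ∈ W, S (T x) = x) : IsEmbedding S (W.map T) (η / (1 - η)) := by
  rintro _ ⟨x, hx, rfl⟩ _ ⟨y, hy, rfl⟩
  rw [hS x hx, hS y hy, abs_sub_comm]
  refine (h x hx y hy).trans ?_
  rw [div_mul_eq_mul_div, le_div_iff₀ (by linarith), mul_assoc]
  refine mul_le_mul_of_nonneg_left ?_ hη0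
  have := h.le_norm_mul hη hx hy
  linarith

end IsEmbedding

namespace IsCanonical

variable {q : ℕ} {U V : Submodule ℝ E} {σ σ' : Fin q → ℝ} {a b : Fin q → E}
  {T : E →ₗ[ℝ] F} {η : ℝ}

theorem le_of_embedding {a' b' : Fin q → F} (h : IsCanonical U V σ a b)
    (h' : IsCanonical (U.map T) (V.map T) σ' a' b') (hT : IsEmbedding T (U ⊔ V) η) (i : Fin q) :
    σ i ≤ σ' i * (1 + η) + η :=
  h.le_of_map h' T (fun u hu => ⟨u, hu, rfl⟩) (fun v hv => ⟨v, hv, rfl⟩) hT i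

/-- Apply the perturbation bound backwards, to a left inverse with error `κ = η / (1 - η)`, and
clear the denominator. -/
theorem embedding_le {a' b' : Fin q → F} (h : IsCanonical U V σ a b)
    (h' : IsCanonical (U.map T) (V.map T) σ' a' b') (hT : IsEmbedding T (U ⊔ V) η)
    (hη0 : 0 ≤ η) (hη : η < 1) (i : Fin q) : σ' i * (1 - η) ≤ σ i + η := by
  obtain ⟨S, hS⟩ := hT.exists_left_inverse hη
  have h1 := hT.left_inverse hη0 hη hS
  rw [Submodule.map_sup] at h1
  have h2 := h'.le_of_map h S
    (by rintro _ ⟨u, hu, rfl⟩; rw [hS u (Submodule.mem_sup_left hu)]; exact hu)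
    (by rintro _ ⟨u, hu, rfl⟩; rw [hS u (Submodule.mem_sup_right hu)]; exact hu) h1 i
  have h3 : 0 < 1 - η := by linarith
  have h4 : σ i * (1 + η / (1 - η)) + η / (1 - η) = (σ i + η) / (1 - η) := by
    field_simp; ring
  rw [h4, le_div_iff₀ h3] at h2
  exact h2

theorem abs_sub_le_of_embedding {a' b' : Fin q → F} (h : IsCanonical U V σ a b)
    (h' : IsCanonical (U.map T) (V.map T) σ' a' b') (hT : IsEmbedding T (U ⊔ V) η)
    (hη0 : 0 ≤ η) (hη : η < 1) (i : Fin q) : |σ i - σ' i| ≤ 2 * η := by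
  have h1 := h.le_of_embedding h' hT i
  have h2 := h.embedding_le h' hT hη0 hη i
  have h3 := mul_le_mul_of_nonneg_right (h'.le_one i) hη0
  rw [abs_le]
  constructor <;> nlinarith

end IsCanonical

theorem IsEmbedding.norm_sq_bounds {T : E →ₗ[ℝ] F} {W : Submodule ℝ E} {ε : ℝ} (hε0 : 0 < ε)
    (hε : ε < 1 / 3) (hT : IsEmbedding T W (ε / 15)) {x : E} (hx : x ∈ W) (hx1 : ‖T x‖ = 1) :
    1 / (1 + ε / 3) ≤ ‖x‖ ^ 2 ∧ ‖x‖ ^ 2 ≤ 1 / (1 - ε / 3) := by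
  have h1 := hT.norm_sq_le hx
  have h2 := hT.le_norm_sq hx
  rw [hx1] at h1 h2
  have h3 := sq_nonneg ‖x‖
  constructor
  · rw [div_le_iff₀ (by linarith)]; nlinarith
  · rw [le_div_iff₀ (by linarith)]; nlinarith

theorem IsEmbedding.abs_inner_le {T : E →ₗ[ℝ] F} {W : Submodule ℝ E} {ε : ℝ} (hε0 : 0 < ε)
    (hε : ε < 1 / 3) (hT : IsEmbedding T W (ε / 15)) {x y : E} (hx : x ∈ W) (hy : y ∈ W)
    (hx1 : ‖T x‖ = 1) (hy1 : ‖T y‖ = 1) (hxy : inner ℝ (T x) (T y) = 0) :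
    |inner ℝ x y| ≤ ε / (3 - ε) := by
  have h1 := hT x hx y hy
  rw [hxy, zero_sub, abs_neg] at h1
  have h2 := hT.le_norm_mul (by linarith) hx hy
  rw [hx1, hy1] at h2
  refine h1.trans ?_
  rw [le_div_iff₀ (by linarith)]
  have h3 : 0 ≤ ‖x‖ * ‖y‖ := by positivity
  nlinarith [mul_nonneg hε0.le h3, mul_nonneg (mul_nonneg hε0.le hε0.le) h3]

/-- With `η = ε / 15` and unit sketched norms, `‖x‖ * ‖y‖` lies between `1 / (1 + η)` and `1 / (1 -
η)`. The true correlation is therefore between `s' * (1 - η) - η` and `s' * (1 + η) + η`; the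
comparison of `s` with `s'` then replaces `s'`. -/
theorem IsEmbedding.inner_div_bounds {T : E →ₗ[ℝ] F} {W : Submodule ℝ E} {ε s s' : ℝ}
    (hε0 : 0 < ε) (hε : ε < 1 / 3) (hT : IsEmbedding T W (ε / 15)) {x y : E} (hx : x ∈ W)
    (hy : y ∈ W) (hx1 : ‖T x‖ = 1) (hy1 : ‖T y‖ = 1) (hxy : |inner ℝ (T x) (T y)| = s')
    (h1 : s ≤ s' * (1 + ε / 15) + ε / 15) (h2 : s' * (1 - ε / 15) ≤ s + ε / 15) :
    s / (1 + ε / 3) - (ε / 3) / (1 - ε / 9) ≤ |inner ℝ x y| / (‖x‖ * ‖y‖) ∧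
      |inner ℝ x y| / (‖x‖ * ‖y‖) ≤ s / (1 - ε / 3) + (ε / 3) / (1 - ε / 3) ^ 2 := by
  obtain ⟨η, rfl⟩ : ∃ η, ε = 15 * η := ⟨ε / 15, by ring⟩
  have e1 : 15 * η / 15 = η := by ring
  have e2 : 15 * η / 3 = 5 * η := by ring
  have e3 : 15 * η / 9 = 5 / 3 * η := by ring
  rw [e1] at hT h1 h2
  rw [e2, e3]
  have hη0 : 0 < η := by linarith
  have hη : η < 1 / 45 := by linarith
  have hs' : 0 ≤ s' := hxy ▸ abs_nonneg _
  have g1 := hT.norm_mul_le hη0.le hx hy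
  have g2 := hT.le_norm_mul (by linarith) hx hy
  rw [hx1, hy1] at g1 g2
  have g3 := hT x hx y hy
  set P := ‖x‖ * ‖y‖ with hP
  have hP0 : 0 < P := by nlinarith
  have g4 : |inner ℝ x y| ≤ s' + η * P := by
    have := abs_sub_abs_le_abs_sub (inner ℝ x y) (inner ℝ (T x) (T y))
    rw [abs_sub_comm, hxy] at this
    linarith
  have g5 : s' - η * P ≤ |inner ℝ x y| := by
    have := abs_sub_abs_le_abs_sub (inner ℝ (T x) (T y)) (inner ℝ x y)
    rw [hxy] at this
    linarith
  have k1 : |inner ℝ x y| / P ≤ s' * (1 + η) + η := by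
    rw [div_le_iff₀ hP0]; nlinarith
  have k2 : s' * (1 - η) - η ≤ |inner ℝ x y| / P := by
    rw [le_div_iff₀ hP0]; nlinarith
  have p1 : 0 < 1 - 5 * η := by linarith
  constructor
  · refine le_trans ?_ k2
    have m1 : s / (1 + 5 * η) ≤ s' * (1 - η) + η := by
      rw [div_le_iff₀ (by linarith)]
      nlinarith [mul_nonneg hs' (mul_nonneg hη0.le (by linarith : 0 ≤ 3 - 5 * η))]
    have m2 : 2 * η ≤ 5 * η / (1 - 5 / 3 * η) := by
      rw [le_div_iff₀ (by linarith)]; nlinarith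
    linarith
  · refine k1.trans ?_
    have m1 : s' * (1 + η) ≤ (s + η) / (1 - 5 * η) := by
      rw [le_div_iff₀ p1]
      nlinarith [mul_nonneg hs' (mul_nonneg hη0.le (by linarith : 0 ≤ 3 + 5 * η))]
    have m2 : η / (1 - 5 * η) + η ≤ 5 * η / (1 - 5 * η) ^ 2 := by
      rw [div_add' _ _ _ p1.ne', div_le_div_iff₀ p1 (by positivity)]
      have : η + η * (1 - 5 * η) ≤ 2 * η := by nlinarith
      nlinarith [mul_le_mul_of_nonneg_right this (by positivity : 0 ≤ (1 - 5 * η) ^ 2),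
        mul_pos hη0 p1]
    rw [add_div] at m1
    linarith

/-- The Frobenius norm of the error matrix in an orthonormal basis controls the embedding. -/
theorem isEmbedding_of_sum_sq {ι : Type*} [Fintype ι] {W : Submodule ℝ E}
    (e : OrthonormalBasis ι ℝ W) (T : E →ₗ[ℝ] F) {η : ℝ} (hη : 0 ≤ η)
    (h : ∑ k, ∑ l, (inner ℝ (T (e k)) (T (e l)) - inner ℝ (e k : E) (e l : E)) ^ 2 ≤ η ^ 2) :
    IsEmbedding T W η := by
  have key : ∀ x y : W,
      |inner ℝ (T x) (T y) - inner ℝ (x : E) (y : E)| ≤ η * (‖x‖ * ‖y‖) := by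
    intro x y
    have hexp : inner ℝ (T x) (T y) - inner ℝ (x : E) (y : E) =
        ∑ p : ι × ι, (e.repr x p.1 * e.repr y p.2) *
          (inner ℝ (T (e p.1)) (T (e p.2)) - inner ℝ (e p.1 : E) (e p.2 : E)) := by
      have hx : (x : E) = ∑ k, e.repr x k • (e k : E) := by
        conv_lhs => rw [← e.sum_repr x]
        simp
      have hy : (y : E) = ∑ k, e.repr y k • (e k : E) := by
        conv_lhs => rw [← e.sum_repr y]
        simp
      rw [hx, hy, map_sum, map_sum, sum_inner, sum_inner, Fintype.sum_prod_type,
        ← Finset.sum_sub_distrib]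
      refine Finset.sum_congr rfl fun k _ => ?_
      rw [inner_sum, inner_sum, ← Finset.sum_sub_distrib]
      refine Finset.sum_congr rfl fun l _ => ?_
      simp only [map_smul, inner_smul_left, inner_smul_right, conj_trivial]
      ring
    refine abs_le_of_sq_le_sq ?_ (by positivity)
    rw [hexp]
    -- Cauchy–Schwarz over index pairs: the coefficient array has rank one and Frobenius norm `‖x‖ *
    -- ‖y‖`.
    refine (Finset.sum_mul_sq_le_sq_mul_sq _ _ _).trans ?_
    have h1 : ∑ p : ι × ι, (e.repr x p.1 * e.repr y p.2) ^ 2 = ‖x‖ ^ 2 * ‖y‖ ^ 2 := by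
      have hn : ∀ z : W, ‖z‖ ^ 2 = ∑ k, e.repr z k ^ 2 := by
        intro z
        rw [← e.repr.norm_map, EuclideanSpace.norm_sq_eq]
        simp
      rw [hn, hn, Finset.sum_mul_sum, Fintype.sum_prod_type]
      simp only [mul_pow]
    rw [h1, Fintype.sum_prod_type, mul_pow, mul_pow, mul_comm]
    exact mul_le_mul_of_nonneg_right h (by positivity)
  exact fun x hx y hy => key ⟨x, hx⟩ ⟨y, hy⟩

end Embedding

/-! ### From matrices to column spaces -/

theorem inner_toLp_eq_dotProduct {m : ℕ} (u v : Fin m → ℝ) :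
    inner ℝ (WithLp.toLp 2 u) (WithLp.toLp 2 v) = u ⬝ᵥ v := by
  rw [EuclideanSpace.inner_toLp_toLp, star_trivial, dotProduct_comm]

theorem corr_eq {m : ℕ} (u v : Fin m → ℝ) :
    corr u v = |inner ℝ (WithLp.toLp 2 u) (WithLp.toLp 2 v)| /
      (‖WithLp.toLp 2 u‖ * ‖WithLp.toLp 2 v‖) := by
  rw [inner_toLp_eq_dotProduct]; rfl

/-- The column space of a matrix, as a subspace of Euclidean space. -/
def colSpace {m : ℕ} {ι : Type*} [Fintype ι] (A : Matrix (Fin m) ι ℝ) :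
    Submodule ℝ (EuclideanSpace ℝ (Fin m)) :=
  (LinearMap.range A.mulVecLin).map (WithLp.linearEquiv 2 ℝ (Fin m → ℝ)).symm.toLinearMap

theorem mem_colSpace {m : ℕ} {ι : Type*} [Fintype ι] {A : Matrix (Fin m) ι ℝ}
    {x : EuclideanSpace ℝ (Fin m)} : x ∈ colSpace A ↔ ∃ u, WithLp.toLp 2 (A *ᵥ u) = x := by
  constructor
  · rintro ⟨_, ⟨u, rfl⟩, rfl⟩
    exact ⟨u, rfl⟩
  · rintro ⟨u, rfl⟩
    exact ⟨_, ⟨u, rfl⟩, rfl⟩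

theorem mulVec_mem_colSpace {m : ℕ} {ι : Type*} [Fintype ι] (A : Matrix (Fin m) ι ℝ)
    (u : ι → ℝ) : WithLp.toLp 2 (A *ᵥ u) ∈ colSpace A :=
  mem_colSpace.2 ⟨u, rfl⟩

theorem finrank_colSpace {m : ℕ} {ι : Type*} [Fintype ι] (A : Matrix (Fin m) ι ℝ) :
    Module.finrank ℝ (colSpace A) = A.rank :=
  LinearEquiv.finrank_map_eq _ _

theorem colSpace_mul {r m : ℕ} {ι : Type*} [Fintype ι] (M : Matrix (Fin r) (Fin m) ℝ)
    (A : Matrix (Fin m) ι ℝ) : colSpace (M * A) = (colSpace A).map (M.toEuclideanLin) := by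
  ext x
  simp only [mem_colSpace, Submodule.mem_map]
  constructor
  · rintro ⟨u, rfl⟩
    exact ⟨_, ⟨u, rfl⟩, by rw [← Matrix.mulVec_mulVec]; rfl⟩
  · rintro ⟨_, ⟨u, rfl⟩, rfl⟩
    exact ⟨u, by rw [← Matrix.mulVec_mulVec]; rfl⟩

theorem colSpace_sup_le {m n l : ℕ} (A : Matrix (Fin m) (Fin n) ℝ)
    (B : Matrix (Fin m) (Fin l) ℝ) : colSpace A ⊔ colSpace B ≤ colSpace (fromCols A B) := by
  refine sup_le ?_ ?_
  · intro x hx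
    obtain ⟨u, rfl⟩ := mem_colSpace.1 hx
    exact mem_colSpace.2 ⟨Sum.elim u 0, by simp [Matrix.fromCols_mulVec]⟩
  · intro x hx
    obtain ⟨u, rfl⟩ := mem_colSpace.1 hx
    exact mem_colSpace.2 ⟨Sum.elim 0 u, by simp [Matrix.fromCols_mulVec]⟩

theorem isCCA_iff {m n l q : ℕ} {A : Matrix (Fin m) (Fin n) ℝ} {B : Matrix (Fin m) (Fin l) ℝ}
    {σ : Fin q → ℝ} {x : Fin q → Fin n → ℝ} {y : Fin q → Fin l → ℝ} :
    IsCCA A B σ x y ↔ B.rank = q ∧ q ≤ A.rank ∧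
      IsCanonical (colSpace A) (colSpace B) σ (fun i => WithLp.toLp 2 (A *ᵥ x i))
        (fun i => WithLp.toLp 2 (B *ᵥ y i)) := by
  have hne : ∀ {k : ℕ} {u : Fin k → ℝ}, WithLp.toLp 2 u ≠ 0 ↔ u ≠ 0 := by
    intro k u; simp
  constructor
  · intro h
    refine ⟨h.rank_right, h.rank_left, ?_⟩
    have hpos : ∀ i, 0 < norm2 (A *ᵥ x i) * norm2 (B *ᵥ y i) := fun i =>
      mul_pos (norm_pos_iff.2 (hne.2 (h.left_mem i).1)) (norm_pos_iff.2 (hne.2 (h.right_mem i).1))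
    refine ⟨fun i => mulVec_mem_colSpace _ _, fun i => mulVec_mem_colSpace _ _,
      fun i => hne.2 (h.left_mem i).1, fun i => hne.2 (h.right_mem i).1, ?_, ?_, ?_, ?_⟩
    · intro i j hij
      rw [inner_toLp_eq_dotProduct]; exact (h.left_mem i).2 j hij
    · intro i j hij
      rw [inner_toLp_eq_dotProduct]; exact (h.right_mem i).2 j hij
    · intro i
      rw [h.attained i, inner_toLp_eq_dotProduct]
      exact (div_mul_cancel₀ _ (hpos i).ne').symm
    · intro i u hu hu' v hv hv'
      obtain ⟨u, rfl⟩ := mem_colSpace.1 hu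
      obtain ⟨v, rfl⟩ := mem_colSpace.1 hv
      -- The subspace formulation admits zero vectors, for which the product form of the inequality
      -- is trivial.
      by_cases hu0 : A *ᵥ u = 0
      · simp [hu0]
      by_cases hv0 : B *ᵥ v = 0
      · simp [hv0]
      have h1 := h.maximal i u
        ⟨hu0, fun j hj => by rw [← inner_toLp_eq_dotProduct]; exact hu' j hj⟩ v
        ⟨hv0, fun j hj => by rw [← inner_toLp_eq_dotProduct]; exact hv' j hj⟩
      rw [corr_eq, div_le_iff₀ (mul_pos (norm_pos_iff.2 (hne.2 hu0))
        (norm_pos_iff.2 (hne.2 hv0)))] at h1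
      exact h1
  · rintro ⟨hB, hA, h⟩
    refine ⟨hB, hA, fun i => ⟨hne.1 (h.left_ne i), fun j hj => ?_⟩,
      fun i => ⟨hne.1 (h.right_ne i), fun j hj => ?_⟩, fun i => ?_, ?_⟩
    · rw [← inner_toLp_eq_dotProduct]; exact h.left_orth i j hj
    · rw [← inner_toLp_eq_dotProduct]; exact h.right_orth i j hj
    · rw [corr_eq, h.attained i, mul_div_cancel_right₀]
      exact (mul_pos (norm_pos_iff.2 (h.left_ne i)) (norm_pos_iff.2 (h.right_ne i))).ne'
    · rintro i u ⟨hu0, hu⟩ v ⟨hv0, hv⟩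
      rw [corr_eq, div_le_iff₀ (mul_pos (norm_pos_iff.2 (hne.2 hu0))
        (norm_pos_iff.2 (hne.2 hv0)))]
      exact h.maximal i _ (mulVec_mem_colSpace A u)
        (fun j hj => by rw [inner_toLp_eq_dotProduct]; exact hu j hj) _ (mulVec_mem_colSpace B v)
        (fun j hj => by rw [inner_toLp_eq_dotProduct]; exact hv j hj)

theorem exists_isCCA {m n l q : ℕ} {A : Matrix (Fin m) (Fin n) ℝ}
    {B : Matrix (Fin m) (Fin l) ℝ} (hB : B.rank = q) (hA : q ≤ A.rank) :
    ∃ (σ : Fin q → ℝ) (x : Fin q → Fin n → ℝ) (y : Fin q → Fin l → ℝ), IsCCA A B σ x y := by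
  obtain ⟨σ, a, b, h⟩ := exists_isCanonical q (colSpace A) (colSpace B)
    (by rw [finrank_colSpace]; exact hA) (by rw [finrank_colSpace, hB])
  choose x hx using fun i => mem_colSpace.1 (h.left_mem i)
  choose y hy using fun i => mem_colSpace.1 (h.right_mem i)
  exact ⟨σ, x, y, isCCA_iff.2 ⟨hB, hA, by simpa only [hx, hy] using h⟩⟩

theorem toLp_mulVec_weight {m n q : ℕ} (A : Matrix (Fin m) (Fin n) ℝ) (x : Fin q → Fin n → ℝ)
    (i : Fin q) : WithLp.toLp 2 (A *ᵥ weight A x i) =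
      ‖WithLp.toLp 2 (A *ᵥ x i)‖⁻¹ • WithLp.toLp 2 (A *ᵥ x i) := by
  rw [weight, Matrix.mulVec_smul]; rfl

/-! ### Embedding probability and conclusion -/

/-- The sparse embedding embeds a fixed subspace with high probability. -/
theorem prob_isEmbedding {m r : ℕ} (W : Submodule ℝ (EuclideanSpace ℝ (Fin m))) {ε δ : ℝ}
    (hε : 0 < ε) (hδ : 0 < δ) (hr0 : 0 < r)
    (hr : 225 * ((Module.finrank ℝ W : ℝ) ^ 2 + Module.finrank ℝ W) / (ε ^ 2 * δ) ≤ r) :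
    1 - δ ≤ (sampleLaw m r).real {z | IsEmbedding (sketch z).toEuclideanLin W (ε / 15)} := by
  classical
  have hrpos : (0 : ℝ) < r := by exact_mod_cast hr0
  set w := Module.finrank ℝ W with hw
  set e := stdOrthonormalBasis ℝ W with he
  set g : Fin w → Fin m → ℝ := fun k => WithLp.ofLp (e k : EuclideanSpace ℝ (Fin m)) with hg
  have hgo : ∀ k l, g k ⬝ᵥ g l = if k = l then 1 else 0 := by
    intro k l
    have h1 := orthonormal_iff_ite.1 e.orthonormal k l
    rw [← h1, ← inner_toLp_eq_dotProduct]; rfl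
  set G : Sample m r → ℝ := fun z =>
    ∑ k, ∑ l, ((sketch z *ᵥ g k) ⬝ᵥ (sketch z *ᵥ g l) - g k ⬝ᵥ g l) ^ 2 with hG
  have hG0 : ∀ z, 0 ≤ G z := fun z =>
    Finset.sum_nonneg fun k _ => Finset.sum_nonneg fun l _ => sq_nonneg _
  set N : ℝ := (r : ℝ) ^ m * 2 ^ m with hN
  have hNpos : 0 < N := by positivity
  have hsum : (r : ℝ) * ∑ z, G z ≤ N * ((w : ℝ) ^ 2 + w) := by
    have h1 : ∑ z, G z = ∑ k, ∑ l, ∑ z : Sample m r,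
        ((sketch z *ᵥ g k) ⬝ᵥ (sketch z *ᵥ g l) - g k ⬝ᵥ g l) ^ 2 := by
      rw [hG, Finset.sum_comm]
      exact Finset.sum_congr rfl fun k _ => Finset.sum_comm
    -- For an orthonormal family each pair contributes `1`, and each diagonal pair one more.
    have h2 : (w : ℝ) ^ 2 + w = ∑ k, ∑ l, ((g k ⬝ᵥ g k) * (g l ⬝ᵥ g l) + (g k ⬝ᵥ g l) ^ 2) := by
      simp [hgo, Finset.sum_add_distrib, sq]
    rw [h1, h2]
    rw [Finset.mul_sum, Finset.mul_sum]
    refine Finset.sum_le_sum fun k _ => ?_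
    rw [Finset.mul_sum, Finset.mul_sum]
    exact Finset.sum_le_sum fun l _ => sum_sq_sketch_error _ _
  have hgood : {z | G z ≤ (ε / 15) ^ 2} ⊆
      {z | IsEmbedding (sketch z).toEuclideanLin W (ε / 15)} := by
    intro z hz
    refine isEmbedding_of_sum_sq e _ (by positivity) (le_trans (le_of_eq ?_) hz)
    refine Finset.sum_congr rfl fun k _ => Finset.sum_congr rfl fun l _ => ?_
    rw [← inner_toLp_eq_dotProduct, ← inner_toLp_eq_dotProduct]; rfl
  have hmono : (sampleLaw m r).real {z | G z ≤ (ε / 15) ^ 2} ≤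
      (sampleLaw m r).real {z | IsEmbedding (sketch z).toEuclideanLin W (ε / 15)} := by
    rw [sampleLaw_real hr0, sampleLaw_real hr0]
    refine div_le_div_of_nonneg_right ?_ hNpos.le
    exact_mod_cast Finset.card_le_card fun z hz => by
      simp only [Finset.mem_filter, Finset.mem_univ, true_and] at hz ⊢
      exact hgood hz
  refine le_trans ?_ hmono
  rw [sampleLaw_real hr0, le_div_iff₀ hNpos]
  set S : Finset (Sample m r) := Finset.univ.filter (· ∈ {z | G z ≤ (ε / 15) ^ 2}) with hS
  have hcard : (S.card : ℝ) + (Sᶜ.card : ℝ) = N := by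
    rw [← Nat.cast_add, Finset.card_add_card_compl]
    simp [hN]
  -- Markov's inequality by counting; the threshold `(ε / 15) ^ 2` is the source of `225 = 15 ^ 2`.
  have hbad : (Sᶜ.card : ℝ) * (ε / 15) ^ 2 ≤ ∑ z, G z := by
    rw [← nsmul_eq_mul, ← Finset.sum_const]
    refine (Finset.sum_le_sum fun z hz => ?_).trans
      (Finset.sum_le_sum_of_subset_of_nonneg (Finset.subset_univ Sᶜ) fun z _ _ => hG0 z)
    simp only [hS, Finset.mem_compl, Finset.mem_filter, Finset.mem_univ, true_and,
      Set.mem_ofPred_eq, not_le] at hz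
    exact hz.le
  rw [div_le_iff₀ (by positivity)] at hr
  have h1 : (r : ℝ) * ((Sᶜ.card : ℝ) * (ε / 15) ^ 2) ≤ N * ((w : ℝ) ^ 2 + w) :=
    (mul_le_mul_of_nonneg_left hbad hrpos.le).trans hsum
  have h2 : ((r : ℝ) * ε ^ 2) * (Sᶜ.card : ℝ) ≤ ((r : ℝ) * ε ^ 2) * (δ * N) := by
    nlinarith [mul_le_mul_of_nonneg_left hr hNpos.le]
  have h3 := le_of_mul_le_mul_left h2 (by positivity)
  linarith

/-- The deterministic part: conclusions for one outcome of the sketch that embeds both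
column spaces. -/
theorem sketch_bounds {m r n l q : ℕ} {A : Matrix (Fin m) (Fin n) ℝ}
    {B : Matrix (Fin m) (Fin l) ℝ} {M : Matrix (Fin r) (Fin m) ℝ} {ε : ℝ} (hε0 : 0 < ε)
    (hε : ε < 1 / 3) (hM : IsEmbedding M.toEuclideanLin (colSpace A ⊔ colSpace B) (ε / 15))
    {σ σ' : Fin q → ℝ} {x x' : Fin q → Fin n → ℝ} {y y' : Fin q → Fin l → ℝ}
    (h : IsCCA A B σ x y) (h' : IsCCA (M * A) (M * B) σ' x' y') :
    (∀ i, |σ i - σ' i| ≤ ε + 2 * ε ^ 2 / 9) ∧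
    (∀ c, 1 / (1 + ε / 3) ≤ norm2 (A *ᵥ weight (M * A) x' c) ^ 2 ∧
      norm2 (A *ᵥ weight (M * A) x' c) ^ 2 ≤ 1 / (1 - ε / 3)) ∧
    (∀ i j, i ≠ j → |(A *ᵥ weight (M * A) x' i) ⬝ᵥ (A *ᵥ weight (M * A) x' j)| ≤ ε / (3 - ε)) ∧
    (∀ c, 1 / (1 + ε / 3) ≤ norm2 (B *ᵥ weight (M * B) y' c) ^ 2 ∧
      norm2 (B *ᵥ weight (M * B) y' c) ^ 2 ≤ 1 / (1 - ε / 3)) ∧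
    (∀ i j, i ≠ j → |(B *ᵥ weight (M * B) y' i) ⬝ᵥ (B *ᵥ weight (M * B) y' j)| ≤ ε / (3 - ε)) ∧
    (∀ i, σ i / (1 + ε / 3) - (ε / 3) / (1 - ε / 9) ≤
        corr (A *ᵥ weight (M * A) x' i) (B *ᵥ weight (M * B) y' i) ∧
      corr (A *ᵥ weight (M * A) x' i) (B *ᵥ weight (M * B) y' i) ≤
        σ i / (1 - ε / 3) + (ε / 3) / (1 - ε / 3) ^ 2) := by
  have hc := (isCCA_iff.1 h).2.2
  have hc' := (isCCA_iff.1 h').2.2.normalize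
  have ha1 : ∀ i, ‖WithLp.toLp 2 ((M * A) *ᵥ weight (M * A) x' i)‖ = 1 := fun i => by
    rw [toLp_mulVec_weight]
    exact norm_smul_inv_norm (𝕜 := ℝ) ((isCCA_iff.1 h').2.2.left_ne i)
  have hb1 : ∀ i, ‖WithLp.toLp 2 ((M * B) *ᵥ weight (M * B) y' i)‖ = 1 := fun i => by
    rw [toLp_mulVec_weight]
    exact norm_smul_inv_norm (𝕜 := ℝ) ((isCCA_iff.1 h').2.2.right_ne i)
  simp only [← toLp_mulVec_weight] at hc'
  rw [colSpace_mul, colSpace_mul] at hc'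
  have hMA : ∀ u, WithLp.toLp 2 ((M * A) *ᵥ u) = M.toEuclideanLin (WithLp.toLp 2 (A *ᵥ u)) := by
    intro u; rw [← Matrix.mulVec_mulVec]; rfl
  have hMB : ∀ u, WithLp.toLp 2 ((M * B) *ᵥ u) = M.toEuclideanLin (WithLp.toLp 2 (B *ᵥ u)) := by
    intro u; rw [← Matrix.mulVec_mulVec]; rfl
  have hA : ∀ u, WithLp.toLp 2 (A *ᵥ u) ∈ colSpace A ⊔ colSpace B := fun u =>
    Submodule.mem_sup_left (mulVec_mem_colSpace A u)
  have hB : ∀ u, WithLp.toLp 2 (B *ᵥ u) ∈ colSpace A ⊔ colSpace B := fun u =>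
    Submodule.mem_sup_right (mulVec_mem_colSpace B u)
  simp only [hMA] at ha1 hc'
  simp only [hMB] at hb1 hc'
  refine ⟨fun i => ?_, fun c => hM.norm_sq_bounds hε0 hε (hA _) (ha1 c), fun i j hij => ?_,
    fun c => hM.norm_sq_bounds hε0 hε (hB _) (hb1 c), fun i j hij => ?_, fun i => ?_⟩
  -- The error obtained is `2 * ε / 15`, well below the claimed bound.
  · have := hc.abs_sub_le_of_embedding hc' hM (by positivity) (by linarith) i
    nlinarith
  · rw [← inner_toLp_eq_dotProduct]
    exact hM.abs_inner_le hε0 hε (hA _) (hA _) (ha1 i) (ha1 j) (hc'.left_orth' hij)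
  · rw [← inner_toLp_eq_dotProduct]
    exact hM.abs_inner_le hε0 hε (hB _) (hB _) (hb1 i) (hb1 j) (hc'.symm.left_orth' hij)
  · rw [corr_eq]
    refine hM.inner_div_bounds hε0 hε (hA _) (hB _) (ha1 i) (hb1 i) ?_
      (hc.le_of_embedding hc' hM i) (hc.embedding_le hc' hM (by positivity) (by linarith) i)
    rw [hc'.attained i, ha1, hb1, mul_one, mul_one]

end SketchedCCA

theorem mainTheorem4 (m n l p q r : ℕ) (A : Matrix (Fin m) (Fin n) ℝ)
    (B : Matrix (Fin m) (Fin l) ℝ) (hn : n ≤ m) (hl : l ≤ m)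
    (hA : A.rank = p) (hB : B.rank = q) (hqp : q ≤ p)
    (ε δ : ℝ) (hε0 : 0 < ε) (hε : ε < 1 / 3) (hδ0 : 0 < δ) (hδ : δ < 1)
    (w : ℕ) (hw : w = (Matrix.fromCols A B).rank)
    (hr0 : 0 < r) (hr : 243 * ((w : ℝ) ^ 2 + w) / (ε ^ 2 * δ) ≤ r) (hrm : r ≤ m) :
    (∃ (σ : Fin q → ℝ) (x : Fin q → Fin n → ℝ) (y : Fin q → Fin l → ℝ), IsCCA A B σ x y) ∧
    ∀ (σ : Fin q → ℝ) (x : Fin q → Fin n → ℝ) (y : Fin q → Fin l → ℝ), IsCCA A B σ x y →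
      1 - δ ≤ (sampleLaw m r).real {z |
        (∃ (σ' : Fin q → ℝ) (x' : Fin q → Fin n → ℝ) (y' : Fin q → Fin l → ℝ),
          IsCCA (sketch z * A) (sketch z * B) σ' x' y') ∧
        ∀ (σ' : Fin q → ℝ) (x' : Fin q → Fin n → ℝ) (y' : Fin q → Fin l → ℝ),
          IsCCA (sketch z * A) (sketch z * B) σ' x' y' →
          -- (a)
          (∀ i, |σ i - σ' i| ≤ ε + 2 * ε ^ 2 / 9) ∧
          -- (b) for `A`
          (∀ c, 1 / (1 + ε / 3) ≤ norm2 (A *ᵥ weight (sketch z * A) x' c) ^ 2 ∧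
            norm2 (A *ᵥ weight (sketch z * A) x' c) ^ 2 ≤ 1 / (1 - ε / 3)) ∧
          (∀ i j, i ≠ j → |(A *ᵥ weight (sketch z * A) x' i) ⬝ᵥ
            (A *ᵥ weight (sketch z * A) x' j)| ≤ ε / (3 - ε)) ∧
          -- (b) for `B`
          (∀ c, 1 / (1 + ε / 3) ≤ norm2 (B *ᵥ weight (sketch z * B) y' c) ^ 2 ∧
            norm2 (B *ᵥ weight (sketch z * B) y' c) ^ 2 ≤ 1 / (1 - ε / 3)) ∧
          (∀ i j, i ≠ j → |(B *ᵥ weight (sketch z * B) y' i) ⬝ᵥ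
            (B *ᵥ weight (sketch z * B) y' j)| ≤ ε / (3 - ε)) ∧
          -- (c)
          (∀ i, σ i / (1 + ε / 3) - (ε / 3) / (1 - ε / 9) ≤
              corr (A *ᵥ weight (sketch z * A) x' i) (B *ᵥ weight (sketch z * B) y' i) ∧
            corr (A *ᵥ weight (sketch z * A) x' i) (B *ᵥ weight (sketch z * B) y' i) ≤
              σ i / (1 - ε / 3) + (ε / 3) / (1 - ε / 3) ^ 2)} := by
  have hqA : q ≤ A.rank := hqp.trans hA.ge
  refine ⟨exists_isCCA hB hqA, fun σ x y h => ?_⟩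
  have hε2 : 0 < ε ^ 2 * δ := by positivity
  have hprob := prob_isEmbedding (r := r) (colSpace (fromCols A B)) hε0 hδ0 hr0 (by
    rw [finrank_colSpace, ← hw]
    -- The assumed constant `243` exceeds the `225` needed.
    refine le_trans ?_ hr
    gcongr
    norm_num)
  refine hprob.trans ?_
  have : NeZero r := ⟨hr0.ne'⟩
  have : MeasureTheory.IsProbabilityMeasure (sampleLaw m r) := by
    unfold sampleLaw; infer_instance
  refine MeasureTheory.measureReal_mono fun z hz => ?_
  have hM : IsEmbedding (sketch z).toEuclideanLin (colSpace A ⊔ colSpace B) (ε / 15) :=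
    IsEmbedding.mono hz (colSpace_sup_le A B)
  -- An embedding with `η < 1` is injective on both column spaces, so the sketched matrices keep
  -- their ranks.
  refine ⟨exists_isCCA ?_ ?_, fun σ' x' y' h' => sketch_bounds hε0 hε hM h h'⟩
  · rw [← finrank_colSpace, colSpace_mul, hM.finrank_map (by linarith) le_sup_right,
      finrank_colSpace, hB]
  · rw [← finrank_colSpace, colSpace_mul, hM.finrank_map (by linarith) le_sup_left,
      finrank_colSpace]
    exact hqA
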